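/- Let $C$ be a $\mathbb{Z}_2$-graded $C^*$-algebra and let $E$ be a $\mathbb{Z}_2$-graded Hilbert $C$-module with $C$-valued inner product $\langle\cdot|\cdot\rangle$ (linear in the second variable). Recall that a regular operator on $E$ is a closed, densely defined, $C$-linear operator $\mathcal{D}$ on $E$ whose adjoint $\mathcal{D}^*$ is densely defined and for which $1+\mathcal{D}^*\mathcal{D}$ has dense range; for a regular self-adjoint operator $\mathcal{D}=\mathcal{D}^*$, its bounded transform is the adjointable operator $F_{\mathcal{D}}:=\mathcal{D}(1+\mathcal{D}^2)^{-1/2}$ on $E$. The graded commutator of homogeneous adjointable operators is $[S,T]:=ST-(-1)^{\deg S\cdot\deg T}TS$, extended bilinearly. Let $\mathcal{D}$ and $\mathcal{S}$ be odd regular self-adjoint operators on $E$ such that $\operatorname{Dom}\mathcal{D}\subset\operatorname{Dom}\mathcal{S}$. Suppose there exists a constant $c\in[0,\infty)$ such that for all $\psi\in\operatorname{Dom}\mathcal{D}$ we have, as an inequality in $C$, $$\langle \mathcal{S}\psi\,|\,\mathcal{D}\psi\rangle+\langle \mathcal{D}\psi\,|\,\mathcal{S}\psi\rangle\;\geq\;-c\,\big\langle\psi\,\big|\,(1+\mathcal{D}^2)^{1/2}\psi\big\rangle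 .$$ Then, in the order of the $C^*$-algebra $\operatorname{End}_C(E)$ of adjointable operators on $E$, we have $[F_{\mathcal{D}},F_{\mathcal{S}}]\geq -c$. Moreover, for every $0<\kappa<2$ there exists an $\alpha\in(0,\infty)$ such that $[F_{\mathcal{D}},F_{\alpha\mathcal{S}}]+\kappa$ is positive, i.e. $$[F_{\mathcal{D}},F_{\alpha\mathcal{S}}]\geq-\kappa .$$ -/

import Mathlib

/-! Adjointable operators on a Hilbert C⋆-module, as a C⋆-algebra. -/

namespace HilbertModule

open scoped InnerProductSpace

noncomputable section

set_option linter.unusedSectionVars false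

section Adjointable

variable (C E : Type*) [NonUnitalCStarAlgebra C] [PartialOrder C] [StarOrderedRing C]
  [NormedAddCommGroup E] [NormedSpace ℂ E] [SMul C E] [CStarModule C E]

variable {E} in
theorem ext_inner_right {x y : E} (h : ∀ z : E, ⟪x, z⟫_C = ⟪y, z⟫_C) : x = y := by
  rw [← sub_eq_zero, ← CStarModule.inner_self (A := C), CStarModule.inner_sub_left, h, sub_self]

variable {E} in
theorem ext_inner_left {x y : E} (h : ∀ z : E, ⟪z, x⟫_C = ⟪z, y⟫_C) : x = y := by
  rw [← sub_eq_zero, ← CStarModule.inner_self (A := C), CStarModule.inner_sub_right, h, sub_self]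

variable {C E} in
theorem norm_le_of_inner_self_le {x : E} {b : ℝ} (hb : 0 ≤ b) {a : C}
    (h : ⟪x, x⟫_C ≤ a) (ha : ‖a‖ ≤ b ^ 2) : ‖x‖ ≤ b := by
  have h1 : ‖⟪x, x⟫_C‖ ≤ ‖a‖ :=
    CStarAlgebra.norm_le_norm_of_nonneg_of_le CStarModule.inner_self_nonneg h
  rw [← CStarModule.norm_sq_eq C] at h1
  exact abs_le_of_sq_le_sq' (h1.trans ha) hb |>.2

/-- The bounded operators on `E` that have an adjoint with respect to the `C`-valued
inner product. -/
def adjointables : Subalgebra ℂ (E →L[ℂ] E) where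
  carrier := {T | ∃ S : E →L[ℂ] E, ∀ x y : E, ⟪T x, y⟫_C = ⟪x, S y⟫_C}
  mul_mem' := by
    rintro T T' ⟨S, hS⟩ ⟨S', hS'⟩
    exact ⟨S' * S, fun x y => by simp [hS, hS']⟩
  add_mem' := by
    rintro T T' ⟨S, hS⟩ ⟨S', hS'⟩
    exact ⟨S + S', fun x y => by simp [hS, hS']⟩
  algebraMap_mem' := fun z => ⟨algebraMap ℂ _ (star z), fun x y => by
    simp [Algebra.algebraMap_eq_smul_one]⟩

/-- The algebra `End_C(E)` of adjointable operators on `E`, with the operator norm. -/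
def Adjointable : Type _ := adjointables C E

instance : NormedRing (Adjointable C E) := inferInstanceAs (NormedRing (adjointables C E))

instance : NormedAlgebra ℂ (Adjointable C E) :=
  inferInstanceAs (NormedAlgebra ℂ (adjointables C E))

variable {C E}

namespace Adjointable

/-- The underlying bounded operator. -/
def toCLM (T : Adjointable C E) : E →L[ℂ] E := T.1

instance : CoeFun (Adjointable C E) (fun _ => E → E) := ⟨fun T => T.toCLM⟩

/-- Constructor from a pair of mutually adjoint bounded operators. -/
def mk (T S : E →L[ℂ] E) (h : ∀ x y : E, ⟪T x, y⟫_C = ⟪x, S y⟫_C) : Adjointable C E :=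
  ⟨T, S, h⟩

@[simp] theorem mk_apply (T S : E →L[ℂ] E) (h : ∀ x y : E, ⟪T x, y⟫_C = ⟪x, S y⟫_C) (x : E) :
    mk T S h x = T x := rfl

@[ext] theorem ext {T S : Adjointable C E} (h : ∀ x, T x = S x) : T = S :=
  Subtype.ext (ContinuousLinearMap.ext h)

@[simp] theorem mul_apply (T S : Adjointable C E) (x : E) : (T * S) x = T (S x) := rfl
@[simp] theorem one_apply (x : E) : (1 : Adjointable C E) x = x := rfl
@[simp] theorem zero_apply (x : E) : (0 : Adjointable C E) x = 0 := rfl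
@[simp] theorem add_apply (T S : Adjointable C E) (x : E) : (T + S) x = T x + S x := rfl
@[simp] theorem sub_apply (T S : Adjointable C E) (x : E) : (T - S) x = T x - S x := rfl
@[simp] theorem neg_apply (T : Adjointable C E) (x : E) : (-T) x = -T x := rfl
@[simp] theorem smul_apply (z : ℂ) (T : Adjointable C E) (x : E) : (z • T) x = z • T x := rfl

theorem norm_def (T : Adjointable C E) : ‖T‖ = ‖T.toCLM‖ := rfl

theorem le_opNorm (T : Adjointable C E) (x : E) : ‖T x‖ ≤ ‖T‖ * ‖x‖ := T.toCLM.le_opNorm x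

theorem exists_adjoint (T : Adjointable C E) :
    ∃ S : Adjointable C E, ∀ x y : E, ⟪T x, y⟫_C = ⟪x, S y⟫_C := by
  obtain ⟨S, hS⟩ := T.2
  refine ⟨⟨S, T.1, fun x y => ?_⟩, hS⟩
  rw [← CStarModule.star_inner y (S x), ← hS, CStarModule.star_inner]

end Adjointable

instance : Star (Adjointable C E) := ⟨fun T => T.exists_adjoint.choose⟩

theorem Adjointable.inner_left (T : Adjointable C E) (x y : E) :
    ⟪T x, y⟫_C = ⟪x, star T y⟫_C := T.exists_adjoint.choose_spec x y

theorem Adjointable.inner_right (T : Adjointable C E) (x y : E) :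
    ⟪x, T y⟫_C = ⟪star T x, y⟫_C := by
  rw [← CStarModule.star_inner, T.inner_left, CStarModule.star_inner]

theorem Adjointable.eq_star_of_inner {T S : Adjointable C E}
    (h : ∀ x y : E, ⟪T x, y⟫_C = ⟪x, S y⟫_C) : star T = S := by
  ext y
  refine ext_inner_left C fun x => ?_
  rw [← T.inner_left, h]

instance : StarRing (Adjointable C E) where
  star_involutive T := Adjointable.eq_star_of_inner fun x y => by rw [← T.inner_right]
  star_mul S T := Adjointable.eq_star_of_inner fun x y => by
    simp [Adjointable.inner_left]
  star_add S T := Adjointable.eq_star_of_inner fun x y => by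
    simp [Adjointable.inner_left]

instance : StarModule ℂ (Adjointable C E) where
  star_smul z T := Adjointable.eq_star_of_inner fun x y => by
    simp [Adjointable.inner_left]

theorem Adjointable.norm_sq_le (T : Adjointable C E) : ‖T‖ * ‖T‖ ≤ ‖star T * T‖ := by
  have h : ‖T.toCLM‖ ≤ √‖star T * T‖ := by
    refine ContinuousLinearMap.opNorm_le_bound _ (Real.sqrt_nonneg _) fun x => ?_
    refine norm_le_of_inner_self_le (C := C) (by positivity) le_rfl ?_
    have h1 : ⟪T x, T x⟫_C = ⟪x, (star T * T) x⟫_C := by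
      rw [T.inner_left]; rfl
    have h2 := (star T * T).le_opNorm x
    change ‖⟪T x, T x⟫_C‖ ≤ _
    rw [h1, mul_pow, Real.sq_sqrt (norm_nonneg _)]
    refine (CStarModule.norm_inner_le E).trans ?_
    calc ‖x‖ * ‖(star T * T) x‖ ≤ ‖x‖ * (‖star T * T‖ * ‖x‖) := by gcongr
      _ = ‖star T * T‖ * ‖x‖ ^ 2 := by ring
  calc ‖T‖ * ‖T‖ ≤ √‖star T * T‖ * √‖star T * T‖ := mul_self_le_mul_self (norm_nonneg _) h
    _ = _ := Real.mul_self_sqrt (norm_nonneg _)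

instance : CStarRing (Adjointable C E) where
  norm_mul_self_le := Adjointable.norm_sq_le

instance [CompleteSpace E] : CompleteSpace (Adjointable C E) := by
  refine Metric.complete_of_cauchySeq_tendsto fun u hu => ?_
  have hu1 : CauchySeq fun n => (u n).toCLM := by
    rw [Metric.cauchySeq_iff] at hu ⊢
    exact hu
  have hu2 : CauchySeq fun n => (star (u n)).toCLM := by
    rw [Metric.cauchySeq_iff] at hu ⊢
    intro ε hε
    obtain ⟨N, hN⟩ := hu ε hε
    refine ⟨N, fun m hm n hn => ?_⟩
    have h := hN m hm n hn
    rw [dist_eq_norm] at h ⊢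
    rwa [← norm_star, star_sub] at h
  obtain ⟨T, hT⟩ := cauchySeq_tendsto_of_complete hu1
  obtain ⟨S, hS⟩ := cauchySeq_tendsto_of_complete hu2
  have hmem : ∀ x y : E, ⟪T x, y⟫_C = ⟪x, S y⟫_C := by
    intro x y
    have e1 : Filter.Tendsto (fun n => u n x) Filter.atTop (nhds (T x)) :=
      ((ContinuousLinearMap.apply ℂ E x).continuous.tendsto T).comp hT
    have e2 : Filter.Tendsto (fun n => star (u n) y) Filter.atTop (nhds (S y)) :=
      ((ContinuousLinearMap.apply ℂ E y).continuous.tendsto S).comp hS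
    have e3 : Filter.Tendsto (fun n => ⟪u n x, y⟫_C) Filter.atTop (nhds ⟪T x, y⟫_C) :=
      (CStarModule.continuous_inner.tendsto (T x, y)).comp (e1.prodMk_nhds tendsto_const_nhds)
    have e4 : Filter.Tendsto (fun n => ⟪x, star (u n) y⟫_C) Filter.atTop
        (nhds ⟪x, S y⟫_C) :=
      (CStarModule.continuous_inner.tendsto (x, S y)).comp (tendsto_const_nhds.prodMk_nhds e2)
    refine tendsto_nhds_unique e3 (e4.congr fun n => ?_)
    rw [← (u n).inner_left]
  exact ⟨Adjointable.mk T S hmem, tendsto_subtype_rng.2 hT⟩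

instance [CompleteSpace E] : CStarAlgebra (Adjointable C E) where

/-- The order of the C⋆-algebra `End_C(E)`: `S ≤ T` when `T - S` is self-adjoint with
nonnegative spectrum. -/
instance [CompleteSpace E] : PartialOrder (Adjointable C E) :=
  CStarAlgebra.spectralOrder _

instance [CompleteSpace E] : StarOrderedRing (Adjointable C E) :=
  CStarAlgebra.spectralOrderedRing _

end Adjointable

/-! Unbounded operators on a Hilbert C⋆-module: adjoints, regularity, self-adjointness. -/

section Unbounded

variable (C : Type*) {E : Type*} [NonUnitalCStarAlgebra C] [PartialOrder C] [StarOrderedRing C]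
  [NormedAddCommGroup E] [NormedSpace ℂ E] [SMul C E] [CStarModule C E]

/-- The pairs `(φ, η)` with `⟪D ψ, φ⟫ = ⟪ψ, η⟫` for all `ψ` in the domain of `D`. -/
def adjointGraph (D : E →ₗ.[ℂ] E) : Submodule ℂ (E × E) where
  carrier := {p | ∀ ψ : D.domain, ⟪D ψ, p.1⟫_C = ⟪(ψ : E), p.2⟫_C}
  add_mem' := fun {p q} hp hq ψ => by simp [hp ψ, hq ψ]
  zero_mem' := fun ψ => by simp
  smul_mem' := fun z p hp ψ => by simp [hp ψ]

/-- The adjoint `D⋆` of a densely defined operator `D`: `φ` is in its domain, with `D⋆ φ = η`,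
when `⟪D ψ, φ⟫ = ⟪ψ, η⟫` for all `ψ` in the domain of `D`. -/
def adjoint (D : E →ₗ.[ℂ] E) : E →ₗ.[ℂ] E := (adjointGraph C D).toLinearPMap

/-- A regular operator on a Hilbert `C`-module: a closed, densely defined, `C`-linear operator `D`
such that `D⋆` is densely defined and `1 + D⋆ D` has dense range. -/
structure IsRegular (D : E →ₗ.[ℂ] E) : Prop where
  dense_domain : Dense (D.domain : Set E)
  smul_mem : ∀ (a : C) (ψ : E), ψ ∈ D.domain → a • ψ ∈ D.domain
  map_smul : ∀ (a : C) (ψ : D.domain), D ⟨a • (ψ : E), smul_mem a ψ ψ.2⟩ = a • D ψ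
  isClosed_graph : IsClosed (D.graph : Set (E × E))
  dense_domain_adjoint : Dense ((adjoint C D).domain : Set E)
  dense_range : Dense {χ : E | ∃ (ψ : D.domain) (h : D ψ ∈ (adjoint C D).domain),
    (ψ : E) + adjoint C D ⟨D ψ, h⟩ = χ}

/-- A regular operator `D` with `D⋆ = D`. -/
structure IsRegularSelfAdjoint (D : E →ₗ.[ℂ] E) : Prop extends IsRegular C D where
  adjoint_eq : adjoint C D = D

variable {C}

theorem mem_graph_adjoint {D : E →ₗ.[ℂ] E} (hD : Dense (D.domain : Set E)) {x y : E} :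
    (x, y) ∈ (adjoint C D).graph ↔ ∀ ψ : D.domain, ⟪D ψ, x⟫_C = ⟪(ψ : E), y⟫_C := by
  rw [adjoint, Submodule.toLinearPMap_graph_eq]
  · rfl
  · rintro ⟨x, y⟩ h (rfl : x = 0)
    have h1 : ∀ z : E, ⟪z, y⟫_C = 0 := by
      intro z
      refine hD.induction (P := fun z => ⟪z, y⟫_C = 0) (fun ψ hψ => ?_) ?_ z
      · have := h ⟨ψ, hψ⟩
        simpa using this.symm
      · exact isClosed_eq (CStarModule.continuous_inner.comp
          (continuous_id.prodMk continuous_const)) continuous_const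
    exact CStarModule.inner_self.1 (h1 y)

namespace IsRegularSelfAdjoint

variable {D : E →ₗ.[ℂ] E}

theorem mem_graph_iff (hD : IsRegularSelfAdjoint C D) {x y : E} :
    (x, y) ∈ D.graph ↔ ∀ ψ : D.domain, ⟪D ψ, x⟫_C = ⟪(ψ : E), y⟫_C := by
  rw [← mem_graph_adjoint hD.dense_domain, hD.adjoint_eq]

theorem symmetric (hD : IsRegularSelfAdjoint C D) {x y u v : E} (h : (x, y) ∈ D.graph) (h' : (u, v) ∈ D.graph) :
    ⟪y, u⟫_C = ⟪x, v⟫_C := by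
  obtain ⟨ψ, rfl, rfl⟩ := (LinearPMap.mem_graph_iff D).1 h
  exact hD.mem_graph_iff.1 h' ψ

theorem inner_add_inner (hD : IsRegularSelfAdjoint C D) {x y w : E} (h : (x, y) ∈ D.graph) (h' : (y, w) ∈ D.graph) :
    ⟪x, x⟫_C + ⟪y, y⟫_C = ⟪x, x + w⟫_C := by
  rw [CStarModule.inner_add_right, hD.symmetric h h']

theorem norm_le (hD : IsRegularSelfAdjoint C D) {x y w : E} (h : (x, y) ∈ D.graph) (h' : (y, w) ∈ D.graph) :
    ‖x‖ ≤ ‖x + w‖ ∧ ‖y‖ ≤ ‖x + w‖ := by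
  have key := hD.inner_add_inner h h'
  have hx : ‖⟪x, x⟫_C‖ ≤ ‖⟪x, x + w⟫_C‖ := by
    refine CStarAlgebra.norm_le_norm_of_nonneg_of_le CStarModule.inner_self_nonneg ?_
    rw [← key]
    exact le_add_of_nonneg_right CStarModule.inner_self_nonneg
  have hy : ‖⟪y, y⟫_C‖ ≤ ‖⟪x, x + w⟫_C‖ := by
    refine CStarAlgebra.norm_le_norm_of_nonneg_of_le CStarModule.inner_self_nonneg ?_
    rw [← key]
    exact le_add_of_nonneg_left CStarModule.inner_self_nonneg
  have hi : ‖⟪x, x + w⟫_C‖ ≤ ‖x‖ * ‖x + w‖ := CStarModule.norm_inner_le E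
  rw [← CStarModule.norm_sq_eq C] at hx hy
  have h1 : ‖x‖ ≤ ‖x + w‖ := by
    by_contra hlt
    push Not at hlt
    nlinarith [norm_nonneg (x + w), norm_nonneg x]
  refine ⟨h1, ?_⟩
  by_contra hlt
  push Not at hlt
  nlinarith [norm_nonneg (x + w), norm_nonneg x, norm_nonneg y]

theorem eq_zero (hD : IsRegularSelfAdjoint C D) {x y w : E} (h : (x, y) ∈ D.graph) (h' : (y, w) ∈ D.graph)
    (h0 : x + w = 0) : x = 0 ∧ y = 0 := by
  have := hD.norm_le h h'
  rw [h0, norm_zero] at this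
  exact ⟨norm_le_zero_iff.1 this.1, norm_le_zero_iff.1 this.2⟩

theorem exists_dense (hD : IsRegularSelfAdjoint C D) : Dense {χ : E | ∃ x y w : E, (x, y) ∈ D.graph ∧ (y, w) ∈ D.graph ∧
    x + w = χ} := by
  refine hD.dense_range.mono ?_
  rintro χ ⟨ψ, h, rfl⟩
  refine ⟨ψ, D ψ, _, D.mem_graph ψ, ?_, rfl⟩
  exact hD.mem_graph_iff.2
    ((mem_graph_adjoint hD.dense_domain).1 ((adjoint C D).mem_graph ⟨D ψ, h⟩))

variable [CompleteSpace E]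

/-- `1 + D²` is surjective. -/
theorem exists_solution (hD : IsRegularSelfAdjoint C D) (z : E) :
    ∃ x y w : E, (x, y) ∈ D.graph ∧ (y, w) ∈ D.graph ∧ x + w = z := by
  obtain ⟨u, hu, hlim⟩ := mem_closure_iff_seq_limit.1 (hD.exists_dense z)
  choose x y w hxy hyw hsum using hu
  have hc := hlim.cauchySeq
  have hb : ∀ m n, ‖x m - x n‖ ≤ ‖u m - u n‖ ∧ ‖y m - y n‖ ≤ ‖u m - u n‖ := by
    intro m n
    have h1 : (x m - x n, y m - y n) ∈ D.graph := D.graph.sub_mem (hxy m) (hxy n)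
    have h2 : (y m - y n, w m - w n) ∈ D.graph := D.graph.sub_mem (hyw m) (hyw n)
    have h3 : x m - x n + (w m - w n) = u m - u n := by rw [← hsum m, ← hsum n]; abel
    have := hD.norm_le h1 h2
    rwa [h3] at this
  have hx : CauchySeq x := by
    rw [Metric.cauchySeq_iff] at hc ⊢
    intro ε hε
    obtain ⟨N, hN⟩ := hc ε hε
    refine ⟨N, fun m hm n hn => ?_⟩
    have := hN m hm n hn
    rw [dist_eq_norm] at this ⊢
    exact (hb m n).1.trans_lt this
  have hy : CauchySeq y := by
    rw [Metric.cauchySeq_iff] at hc ⊢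
    intro ε hε
    obtain ⟨N, hN⟩ := hc ε hε
    refine ⟨N, fun m hm n hn => ?_⟩
    have := hN m hm n hn
    rw [dist_eq_norm] at this ⊢
    exact (hb m n).2.trans_lt this
  obtain ⟨x', hx'⟩ := cauchySeq_tendsto_of_complete hx
  obtain ⟨y', hy'⟩ := cauchySeq_tendsto_of_complete hy
  have hw' : Filter.Tendsto w Filter.atTop (nhds (z - x')) := by
    refine (hlim.sub hx').congr fun n => ?_
    rw [← hsum n]; abel
  refine ⟨x', y', z - x', ?_, ?_, by abel⟩
  · exact hD.isClosed_graph.mem_of_tendsto (hx'.prodMk_nhds hy') (Filter.Eventually.of_forall hxy)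
  · exact hD.isClosed_graph.mem_of_tendsto (hy'.prodMk_nhds hw') (Filter.Eventually.of_forall hyw)

theorem exists_resolvent (hD : IsRegularSelfAdjoint C D) : ∃ R B : E →L[ℂ] E, ∀ z : E,
    (R z, B z) ∈ D.graph ∧ (B z, z - R z) ∈ D.graph := by
  choose x y w hxy hyw hsum using hD.exists_solution
  have hw : ∀ z, w z = z - x z := fun z => eq_sub_of_add_eq' (hsum z)
  simp only [hw] at hyw
  have uniq : ∀ z x' y' w' : E, (x', y') ∈ D.graph → (y', w') ∈ D.graph → x' + w' = z →
      x z = x' ∧ y z = y' := by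
    intro z x' y' w' h1 h2 h3
    have h4 : (x z - x', y z - y') ∈ D.graph := D.graph.sub_mem (hxy z) h1
    have h5 : (y z - y', z - x z - w') ∈ D.graph := D.graph.sub_mem (hyw z) h2
    have := hD.eq_zero h4 h5 (by rw [← h3]; abel)
    exact ⟨sub_eq_zero.1 this.1, sub_eq_zero.1 this.2⟩
  have hadd : ∀ z z', x (z + z') = x z + x z' ∧ y (z + z') = y z + y z' := fun z z' =>
    uniq _ _ _ _ (D.graph.add_mem (hxy z) (hxy z')) (D.graph.add_mem (hyw z) (hyw z'))
      (by simp only []; abel)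
  have hsmul : ∀ (c : ℂ) z, x (c • z) = c • x z ∧ y (c • z) = c • y z := fun c z =>
    uniq _ _ _ _ (D.graph.smul_mem c (hxy z)) (D.graph.smul_mem c (hyw z))
      (by rw [← smul_add, add_sub_cancel])
  have hn : ∀ z, ‖x z‖ ≤ ‖z‖ ∧ ‖y z‖ ≤ ‖z‖ := fun z => by
    simpa using hD.norm_le (hxy z) (hyw z)
  let Rl : E →ₗ[ℂ] E := ⟨⟨x, fun a b => (hadd a b).1⟩, fun c z => (hsmul c z).1⟩
  let Bl : E →ₗ[ℂ] E := ⟨⟨y, fun a b => (hadd a b).2⟩, fun c z => (hsmul c z).2⟩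
  refine ⟨Rl.mkContinuous 1 fun z => ?_, Bl.mkContinuous 1 fun z => ?_, fun z => ?_⟩
  · rw [one_mul]; exact (hn z).1
  · rw [one_mul]; exact (hn z).2
  · exact ⟨hxy z, hyw z⟩

theorem exists_resolvent_adjointable (hD : IsRegularSelfAdjoint C D) : ∃ R B : Adjointable C E,
    ∀ z : E, (R z, B z) ∈ D.graph ∧ (B z, z - R z) ∈ D.graph := by
  obtain ⟨R, B, h⟩ := hD.exists_resolvent
  refine ⟨Adjointable.mk R R fun z w => ?_, Adjointable.mk B B fun z w => ?_, h⟩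
  · have h1 := hD.symmetric (h z).2 (h w).1
    have h2 := hD.symmetric (h z).1 (h w).2
    rw [CStarModule.inner_sub_left] at h1
    rw [CStarModule.inner_sub_right] at h2
    rw [h2] at h1
    simpa using h1.symm
  · have h1 := hD.symmetric (h z).2 (h w).2
    have h2 := hD.symmetric (h z).1 (h w).1
    rw [CStarModule.inner_sub_left, CStarModule.inner_sub_right] at h1
    rw [h2] at h1
    have := congrArg (· + ⟪R z, B w⟫_C) h1
    simpa using this.symm

/-- The resolvent `(1 + D²)⁻¹`, as an adjointable operator. -/
def oneAddSqInv (hD : IsRegularSelfAdjoint C D) : Adjointable C E := hD.exists_resolvent_adjointable.choose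

/-- The operator `D (1 + D²)⁻¹`, as an adjointable operator. -/
def mulOneAddSqInv (hD : IsRegularSelfAdjoint C D) : Adjointable C E :=
  hD.exists_resolvent_adjointable.choose_spec.choose

theorem oneAddSqInv_mem (hD : IsRegularSelfAdjoint C D) (z : E) : (hD.oneAddSqInv z, hD.mulOneAddSqInv z) ∈ D.graph :=
  (hD.exists_resolvent_adjointable.choose_spec.choose_spec z).1

theorem mulOneAddSqInv_mem (hD : IsRegularSelfAdjoint C D) (z : E) :
    (hD.mulOneAddSqInv z, z - hD.oneAddSqInv z) ∈ D.graph :=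
  (hD.exists_resolvent_adjointable.choose_spec.choose_spec z).2

/-- `x = (1 + D²)⁻¹ z` is the only solution of `(1 + D²) x = z`. -/
theorem oneAddSqInv_eq (hD : IsRegularSelfAdjoint C D) {x y z : E} (h : (x, y) ∈ D.graph) (h' : (y, z - x) ∈ D.graph) :
    hD.oneAddSqInv z = x ∧ hD.mulOneAddSqInv z = y := by
  have h4 := D.graph.sub_mem (hD.oneAddSqInv_mem z) h
  have h5 := D.graph.sub_mem (hD.mulOneAddSqInv_mem z) h'
  have := hD.eq_zero h4 h5 (by simp only []; abel)
  exact ⟨sub_eq_zero.1 this.1, sub_eq_zero.1 this.2⟩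

theorem isSelfAdjoint_oneAddSqInv (hD : IsRegularSelfAdjoint C D) : IsSelfAdjoint hD.oneAddSqInv :=
  Adjointable.eq_star_of_inner fun z w => by
    have h1 := hD.symmetric (hD.mulOneAddSqInv_mem z) (hD.oneAddSqInv_mem w)
    have h2 := hD.symmetric (hD.oneAddSqInv_mem z) (hD.mulOneAddSqInv_mem w)
    rw [CStarModule.inner_sub_left] at h1
    rw [CStarModule.inner_sub_right] at h2
    rw [h2] at h1
    simpa using h1.symm

theorem isSelfAdjoint_mulOneAddSqInv (hD : IsRegularSelfAdjoint C D) : IsSelfAdjoint hD.mulOneAddSqInv :=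
  Adjointable.eq_star_of_inner fun z w => by
    have h1 := hD.symmetric (hD.mulOneAddSqInv_mem z) (hD.mulOneAddSqInv_mem w)
    have h2 := hD.symmetric (hD.oneAddSqInv_mem z) (hD.oneAddSqInv_mem w)
    rw [CStarModule.inner_sub_left, CStarModule.inner_sub_right, h2] at h1
    have := congrArg (· + ⟪hD.oneAddSqInv z, hD.mulOneAddSqInv w⟫_C) h1
    simpa using this.symm

theorem mulOneAddSqInv_mul_self (hD : IsRegularSelfAdjoint C D) : hD.mulOneAddSqInv * hD.mulOneAddSqInv =
    hD.oneAddSqInv - hD.oneAddSqInv * hD.oneAddSqInv := by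
  ext w
  refine ext_inner_left C fun z => ?_
  have h := hD.symmetric (hD.oneAddSqInv_mem z) (hD.mulOneAddSqInv_mem w)
  rw [Adjointable.mul_apply, Adjointable.inner_right, hD.isSelfAdjoint_mulOneAddSqInv.star_eq, h]
  rw [← hD.isSelfAdjoint_oneAddSqInv.star_eq, Adjointable.inner_left, star_star,
    hD.isSelfAdjoint_oneAddSqInv.star_eq]
  rw [(hD.oneAddSqInv).toCLM.map_sub]
  rfl

theorem oneAddSqInv_nonneg (hD : IsRegularSelfAdjoint C D) : 0 ≤ hD.oneAddSqInv := by
  have h : hD.oneAddSqInv = star hD.mulOneAddSqInv * hD.mulOneAddSqInv +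
      star hD.oneAddSqInv * hD.oneAddSqInv := by
    rw [hD.isSelfAdjoint_mulOneAddSqInv.star_eq, hD.isSelfAdjoint_oneAddSqInv.star_eq,
      hD.mulOneAddSqInv_mul_self]
    abel
  rw [h]
  exact add_nonneg (star_mul_self_nonneg _) (star_mul_self_nonneg _)

theorem norm_oneAddSqInv_le (hD : IsRegularSelfAdjoint C D) : ‖hD.oneAddSqInv‖ ≤ 1 :=
  ContinuousLinearMap.opNorm_le_bound _ zero_le_one fun z => by
    have := (hD.norm_le (hD.oneAddSqInv_mem z) (hD.mulOneAddSqInv_mem z)).1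
    rw [add_sub_cancel] at this
    rw [one_mul]
    exact this

/-- The positive square root `(1 + D²)^(-1/2)` of the resolvent. -/
def oneAddSqInvSqrt (hD : IsRegularSelfAdjoint C D) : Adjointable C E := CFC.sqrt hD.oneAddSqInv

theorem oneAddSqInvSqrt_nonneg (hD : IsRegularSelfAdjoint C D) : 0 ≤ hD.oneAddSqInvSqrt := CFC.sqrt_nonneg _

theorem oneAddSqInvSqrt_mul_self (hD : IsRegularSelfAdjoint C D) :
    hD.oneAddSqInvSqrt * hD.oneAddSqInvSqrt = hD.oneAddSqInv :=
  CFC.sqrt_mul_sqrt_self _ hD.oneAddSqInv_nonneg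

end IsRegularSelfAdjoint

end Unbounded

/-! The bounded transform `D (1 + D²)^(-1/2)` and the operator `(1 + D²)^(1/2)`. -/

section BoundedTransform

variable {C E : Type*} [NonUnitalCStarAlgebra C] [PartialOrder C] [StarOrderedRing C]
  [NormedAddCommGroup E] [NormedSpace ℂ E] [SMul C E] [CStarModule C E] [CompleteSpace E]

namespace IsRegularSelfAdjoint

variable {D : E →ₗ.[ℂ] E}

theorem resolvent_of_mem (hD : IsRegularSelfAdjoint C D) {x y : E} (h : (x, y) ∈ D.graph) :
    hD.oneAddSqInv y = hD.mulOneAddSqInv x ∧ hD.mulOneAddSqInv y = x - hD.oneAddSqInv x :=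
  hD.oneAddSqInv_eq (hD.mulOneAddSqInv_mem x) (D.graph.sub_mem h (hD.oneAddSqInv_mem x))

theorem commute (hD : IsRegularSelfAdjoint C D) : Commute hD.mulOneAddSqInv hD.oneAddSqInv := by
  ext w
  have h := (hD.resolvent_of_mem (hD.oneAddSqInv_mem w)).1
  simpa using h.symm

theorem mulOneAddSqInv_mem_closure (hD : IsRegularSelfAdjoint C D) (w : E) :
    hD.mulOneAddSqInv w ∈ closure (Set.range hD.oneAddSqInv) := by
  rw [Metric.mem_closure_iff]
  intro ε hε
  set B := hD.mulOneAddSqInv with hB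
  set δ : ℝ := ε / (‖w‖ + 1) with hδ
  have hδ0 : 0 < δ := by positivity
  have hBs : IsSelfAdjoint B := hD.isSelfAdjoint_mulOneAddSqInv
  have hne : ∀ x : ℝ, x ^ 2 + δ ^ 2 ≠ 0 := fun x => by positivity
  have hcont : Continuous fun x : ℝ => x / (x ^ 2 + δ ^ 2) :=
    continuous_id.div (by fun_prop) hne
  have key : B - B * B * cfc (fun x : ℝ => x / (x ^ 2 + δ ^ 2)) B =
      cfc (fun x : ℝ => x - x * x * (x / (x ^ 2 + δ ^ 2))) B := by
    rw [cfc_sub (fun x : ℝ => x) (fun x : ℝ => x * x * (x / (x ^ 2 + δ ^ 2))) B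
      (by fun_prop) ((continuous_id.mul continuous_id).mul hcont).continuousOn,
      cfc_mul (fun x : ℝ => x * x) (fun x : ℝ => x / (x ^ 2 + δ ^ 2)) B
      (by fun_prop) hcont.continuousOn,
      cfc_mul (fun x : ℝ => x) (fun x : ℝ => x) B (by fun_prop) (by fun_prop), cfc_id' ℝ B]
  have hnorm : ‖B - B * B * cfc (fun x : ℝ => x / (x ^ 2 + δ ^ 2)) B‖ ≤ δ / 2 := by
    rw [key]
    refine norm_cfc_le (by positivity) fun x _ => ?_
    have h1 : x - x * x * (x / (x ^ 2 + δ ^ 2)) = x * δ ^ 2 / (x ^ 2 + δ ^ 2) := by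
      field_simp [hne x]
      ring
    rw [h1, Real.norm_eq_abs, abs_div, abs_of_pos (show 0 < x ^ 2 + δ ^ 2 by positivity),
      div_le_iff₀ (by positivity), abs_mul, abs_of_pos (show 0 < δ ^ 2 by positivity)]
    nlinarith [sq_nonneg (|x| - δ), sq_abs x]
  refine ⟨_, ⟨((1 - hD.oneAddSqInv) * cfc (fun x : ℝ => x / (x ^ 2 + δ ^ 2)) B) w, rfl⟩, ?_⟩
  have h2 : B * B = hD.oneAddSqInv * (1 - hD.oneAddSqInv) := by
    rw [hB, hD.mulOneAddSqInv_mul_self, mul_sub, mul_one]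
  rw [← Adjointable.mul_apply, ← mul_assoc, ← h2, dist_eq_norm, ← Adjointable.sub_apply]
  calc _ ≤ δ / 2 * ‖w‖ := (Adjointable.le_opNorm _ _).trans (by gcongr)
    _ ≤ δ / 2 * (‖w‖ + 1) := by gcongr; linarith
    _ = ε / 2 := by rw [hδ]; field_simp
    _ < ε := by linarith

theorem dense_range_oneAddSqInv (hD : IsRegularSelfAdjoint C D) : Dense (Set.range hD.oneAddSqInv) := by
  let K : Submodule ℂ E := (LinearMap.range hD.oneAddSqInv.toCLM.toLinearMap).topologicalClosure
  have hK : (K : Set E) = closure (Set.range hD.oneAddSqInv) := by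
    rw [Submodule.topologicalClosure_coe]
    rfl
  have h : (D.domain : Set E) ⊆ K := by
    intro x hx
    have h1 := (hD.resolvent_of_mem (D.mem_graph ⟨x, hx⟩)).2
    have h2 : x = hD.mulOneAddSqInv (D ⟨x, hx⟩) + hD.oneAddSqInv x := by rw [h1]; simp
    rw [h2]
    refine K.add_mem ?_ ?_
    · rw [← SetLike.mem_coe, hK]; exact hD.mulOneAddSqInv_mem_closure _
    · rw [← SetLike.mem_coe, hK]; exact subset_closure ⟨x, rfl⟩
  intro z
  have h3 := closure_mono h (hD.dense_domain z)
  rwa [hK, closure_closure] at h3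

theorem dense_range_oneAddSqInvSqrt (hD : IsRegularSelfAdjoint C D) : Dense (Set.range hD.oneAddSqInvSqrt) := by
  refine hD.dense_range_oneAddSqInv.mono ?_
  rintro _ ⟨z, rfl⟩
  refine ⟨hD.oneAddSqInvSqrt z, ?_⟩
  rw [← Adjointable.mul_apply, hD.oneAddSqInvSqrt_mul_self]

theorem isSelfAdjoint_oneAddSqInvSqrt (hD : IsRegularSelfAdjoint C D) : IsSelfAdjoint hD.oneAddSqInvSqrt :=
  .of_nonneg hD.oneAddSqInvSqrt_nonneg

theorem norm_mulOneAddSqInv_apply_le (hD : IsRegularSelfAdjoint C D) (w : E) :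
    ‖hD.mulOneAddSqInv w‖ ≤ ‖hD.oneAddSqInvSqrt w‖ := by
  have h1 : ⟪hD.mulOneAddSqInv w, hD.mulOneAddSqInv w⟫_C + ⟪hD.oneAddSqInv w, hD.oneAddSqInv w⟫_C
      = ⟪hD.oneAddSqInvSqrt w, hD.oneAddSqInvSqrt w⟫_C := by
    have e1 := hD.inner_add_inner (hD.oneAddSqInv_mem w) (hD.mulOneAddSqInv_mem w)
    rw [add_sub_cancel] at e1
    rw [add_comm, e1, ← hD.oneAddSqInvSqrt_mul_self, Adjointable.mul_apply,
      Adjointable.inner_left, hD.isSelfAdjoint_oneAddSqInvSqrt.star_eq]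
  refine norm_le_of_inner_self_le (C := C) (norm_nonneg _)
    (a := ⟪hD.oneAddSqInvSqrt w, hD.oneAddSqInvSqrt w⟫_C) ?_ ?_
  · rw [← h1]
    exact le_add_of_nonneg_right CStarModule.inner_self_nonneg
  · rw [CStarModule.norm_sq_eq C]

/-- The range of `(1 + D²)^(-1/2)` lies in the domain of `D`. -/
theorem oneAddSqInvSqrt_mem_domain (hD : IsRegularSelfAdjoint C D) (z : E) : hD.oneAddSqInvSqrt z ∈ D.domain := by
  obtain ⟨u, hu, hlim⟩ := mem_closure_iff_seq_limit.1 (hD.dense_range_oneAddSqInvSqrt z)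
  choose w hw using hu
  have hc := hlim.cauchySeq
  have hB : CauchySeq fun n => hD.mulOneAddSqInv (w n) := by
    rw [Metric.cauchySeq_iff] at hc ⊢
    intro ε hε
    obtain ⟨N, hN⟩ := hc ε hε
    refine ⟨N, fun m hm n hn => ?_⟩
    have := hN m hm n hn
    rw [dist_eq_norm, ← hw, ← hw, ← ContinuousLinearMap.map_sub] at this
    rw [dist_eq_norm, ← ContinuousLinearMap.map_sub]
    exact (hD.norm_mulOneAddSqInv_apply_le _).trans_lt this
  obtain ⟨y, hy⟩ := cauchySeq_tendsto_of_complete hB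
  have hT : Filter.Tendsto (fun n => hD.oneAddSqInv (w n)) Filter.atTop
      (nhds (hD.oneAddSqInvSqrt z)) := by
    refine ((hD.oneAddSqInvSqrt.toCLM.continuous.tendsto z).comp hlim).congr fun n => ?_
    rw [Function.comp_apply, ← hw, ← Adjointable.mul_apply, hD.oneAddSqInvSqrt_mul_self]
  exact LinearPMap.mem_domain_of_mem_graph (hD.isClosed_graph.mem_of_tendsto
    (hT.prodMk_nhds hy) (Filter.Eventually.of_forall fun n => hD.oneAddSqInv_mem (w n)))

theorem exists_boundedTransform (hD : IsRegularSelfAdjoint C D) : ∃ F : Adjointable C E, ∀ z : E,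
    F z = D ⟨hD.oneAddSqInvSqrt z, hD.oneAddSqInvSqrt_mem_domain z⟩ := by
  let Fl : E →ₗ[ℂ] E := D.toFun.comp
    (hD.oneAddSqInvSqrt.toCLM.toLinearMap.codRestrict D.domain hD.oneAddSqInvSqrt_mem_domain)
  have hmem : ∀ z, (hD.oneAddSqInvSqrt z, Fl z) ∈ D.graph := fun z =>
    D.mem_graph ⟨hD.oneAddSqInvSqrt z, hD.oneAddSqInvSqrt_mem_domain z⟩
  let F : E →L[ℂ] E := ⟨Fl, Fl.continuous_of_seq_closed_graph fun u x y hu hFu => by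
    have h1 := hD.isClosed_graph.mem_of_tendsto
      (((hD.oneAddSqInvSqrt.toCLM.continuous.tendsto x).comp hu).prodMk_nhds hFu)
      (Filter.Eventually.of_forall fun n => hmem (u n))
    exact D.mem_graph_snd_inj h1 (hmem x) rfl⟩
  have hFT : ∀ z, F (hD.oneAddSqInvSqrt z) = hD.mulOneAddSqInv z := fun z => by
    refine D.mem_graph_snd_inj (hmem _) (hD.oneAddSqInv_mem z) ?_
    rw [← Adjointable.mul_apply, hD.oneAddSqInvSqrt_mul_self]
  have hcomm : Commute hD.oneAddSqInvSqrt hD.mulOneAddSqInv :=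
    hD.commute.symm.cfcₙ_nnreal _
  have hsymm : ∀ z w, ⟪F (hD.oneAddSqInvSqrt z), hD.oneAddSqInvSqrt w⟫_C =
      ⟪hD.oneAddSqInvSqrt z, F (hD.oneAddSqInvSqrt w)⟫_C := fun z w => by
    rw [hFT, hFT, Adjointable.inner_left, hD.isSelfAdjoint_mulOneAddSqInv.star_eq,
      Adjointable.inner_left, hD.isSelfAdjoint_oneAddSqInvSqrt.star_eq,
      ← Adjointable.mul_apply, ← Adjointable.mul_apply, hcomm.eq]
  refine ⟨Adjointable.mk F F fun x y => ?_, fun z => rfl⟩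
  have hd := hD.dense_range_oneAddSqInvSqrt
  refine hd.induction (P := fun x => ⟪F x, y⟫_C = ⟪x, F y⟫_C) ?_ ?_ x
  · rintro _ ⟨z, rfl⟩
    refine hd.induction (P := fun y => ⟪F (hD.oneAddSqInvSqrt z), y⟫_C =
      ⟪hD.oneAddSqInvSqrt z, F y⟫_C) ?_ ?_ y
    · rintro _ ⟨w, rfl⟩
      exact hsymm z w
    · exact isClosed_eq (CStarModule.continuous_inner.comp
        (continuous_const.prodMk continuous_id)) (CStarModule.continuous_inner.comp
        (continuous_const.prodMk F.continuous))
  · exact isClosed_eq (CStarModule.continuous_inner.comp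
      (F.continuous.prodMk continuous_const)) (CStarModule.continuous_inner.comp
      (continuous_id.prodMk continuous_const))

/-- The bounded transform `F_D = D (1 + D²)^(-1/2)`. -/
def boundedTransform (hD : IsRegularSelfAdjoint C D) : Adjointable C E := hD.exists_boundedTransform.choose

theorem boundedTransform_apply (hD : IsRegularSelfAdjoint C D) (z : E) : hD.boundedTransform z =
    D ⟨hD.oneAddSqInvSqrt z, hD.oneAddSqInvSqrt_mem_domain z⟩ :=
  hD.exists_boundedTransform.choose_spec z

theorem boundedTransform_mem (hD : IsRegularSelfAdjoint C D) (z : E) :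
    (hD.oneAddSqInvSqrt z, hD.boundedTransform z) ∈ D.graph := by
  rw [hD.boundedTransform_apply]
  exact D.mem_graph ⟨hD.oneAddSqInvSqrt z, hD.oneAddSqInvSqrt_mem_domain z⟩

theorem boundedTransform_mul_oneAddSqInvSqrt (hD : IsRegularSelfAdjoint C D) :
    hD.boundedTransform * hD.oneAddSqInvSqrt = hD.mulOneAddSqInv := by
  ext z
  refine D.mem_graph_snd_inj (hD.boundedTransform_mem (hD.oneAddSqInvSqrt z))
    (hD.oneAddSqInv_mem z) ?_
  rw [← Adjointable.mul_apply, hD.oneAddSqInvSqrt_mul_self]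

theorem commute_boundedTransform (hD : IsRegularSelfAdjoint C D) :
    Commute hD.oneAddSqInvSqrt hD.boundedTransform := by
  have hcomm : Commute hD.oneAddSqInvSqrt hD.mulOneAddSqInv :=
    hD.commute.symm.cfcₙ_nnreal _
  ext x
  refine hD.dense_range_oneAddSqInvSqrt.induction (P := fun x =>
    (hD.oneAddSqInvSqrt * hD.boundedTransform) x =
      (hD.boundedTransform * hD.oneAddSqInvSqrt) x) ?_ ?_ x
  · rintro _ ⟨z, rfl⟩
    rw [← Adjointable.mul_apply, ← Adjointable.mul_apply, mul_assoc,
      hD.boundedTransform_mul_oneAddSqInvSqrt, hcomm.eq]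
  · exact isClosed_eq (Adjointable.toCLM _).continuous (Adjointable.toCLM _).continuous

/-- The positive operator `(1 + D²)^(1/2)`, the inverse of `(1 + D²)^(-1/2)`. -/
def sqrtOneAddSq (hD : IsRegularSelfAdjoint C D) : E →ₗ.[ℂ] E :=
  (hD.oneAddSqInvSqrt.toCLM.toLinearMap.toPMap ⊤).inverse

/-- The domain of `(1 + D²)^(1/2)` is that of `D`. -/
theorem sqrtOneAddSq_domain (hD : IsRegularSelfAdjoint C D) : hD.sqrtOneAddSq.domain = D.domain := by
  ext x
  rw [sqrtOneAddSq, LinearPMap.inverse_domain]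
  constructor
  · rintro ⟨z, rfl⟩
    exact hD.oneAddSqInvSqrt_mem_domain z
  · intro hx
    have h1 := (hD.resolvent_of_mem (D.mem_graph ⟨x, hx⟩)).2
    refine ⟨⟨hD.oneAddSqInvSqrt x + hD.boundedTransform (D ⟨x, hx⟩), trivial⟩, ?_⟩
    change hD.oneAddSqInvSqrt (_ + _) = x
    rw [ContinuousLinearMap.map_add, ← Adjointable.mul_apply, ← Adjointable.mul_apply,
      hD.oneAddSqInvSqrt_mul_self, hD.commute_boundedTransform.eq,
      hD.boundedTransform_mul_oneAddSqInvSqrt, h1, add_sub_cancel]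

theorem oneAddSqInvSqrt_injective (hD : IsRegularSelfAdjoint C D) : Function.Injective hD.oneAddSqInvSqrt := by
  refine (injective_iff_map_eq_zero hD.oneAddSqInvSqrt.toCLM).2 fun z hz => ?_
  have h1 : hD.oneAddSqInv z = 0 := by
    rw [← hD.oneAddSqInvSqrt_mul_self, Adjointable.mul_apply]
    rw [hz, map_zero]
  have h2 : hD.mulOneAddSqInv z = 0 := D.graph_fst_eq_zero_snd (hD.oneAddSqInv_mem z) h1
  have h3 := D.graph_fst_eq_zero_snd (hD.mulOneAddSqInv_mem z) h2
  rwa [h1, sub_zero] at h3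

theorem sqrtOneAddSq_apply (hD : IsRegularSelfAdjoint C D) (ψ : hD.sqrtOneAddSq.domain) :
    hD.oneAddSqInvSqrt (hD.sqrtOneAddSq ψ) = ψ := by
  have hker : LinearMap.ker (hD.oneAddSqInvSqrt.toCLM.toLinearMap.toPMap ⊤).toFun = ⊥ := by
    rw [LinearMap.ker_eq_bot]
    intro a b hab
    exact Subtype.ext (hD.oneAddSqInvSqrt_injective hab)
  obtain ⟨z, hz⟩ : ∃ z, hD.oneAddSqInvSqrt z = ψ := by
    have h : ∀ x ∈ hD.sqrtOneAddSq.domain, ∃ z, hD.oneAddSqInvSqrt z = x := by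
      intro x hx
      rw [sqrtOneAddSq, LinearPMap.inverse_domain] at hx
      obtain ⟨z, hz⟩ := hx
      exact ⟨z, hz⟩
    exact h ψ ψ.2
  have h := LinearPMap.inverse_apply_eq hker (y := ψ) (x := ⟨z, trivial⟩) hz
  have h' : hD.sqrtOneAddSq ψ = z := h
  rw [h', hz]

end IsRegularSelfAdjoint

end BoundedTransform

/-! Real multiples of regular self-adjoint operators. -/

section Smul

variable {C E : Type*} [NonUnitalCStarAlgebra C] [PartialOrder C] [StarOrderedRing C]
  [NormedAddCommGroup E] [NormedSpace ℂ E] [SMul C E] [CStarModule C E] [CompleteSpace E]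

theorem smul_mem_graph {D : E →ₗ.[ℂ] E} {x y : E} (h : (x, y) ∈ D.graph) (α : ℝ) :
    (x, α • y) ∈ (α • D).graph := by
  obtain ⟨ψ, rfl, rfl⟩ := (LinearPMap.mem_graph_iff D).1 h
  exact (α • D).mem_graph ψ

theorem mem_smul_graph {D : E →ₗ.[ℂ] E} {α : ℝ} (hα : α ≠ 0) {x y : E} :
    (x, y) ∈ (α • D).graph ↔ (x, α⁻¹ • y) ∈ D.graph := by
  constructor
  · intro h
    have h1 := smul_mem_graph h α⁻¹
    rwa [smul_smul, inv_mul_cancel₀ hα, one_smul] at h1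
  · intro h
    have h1 := smul_mem_graph h α
    rwa [smul_smul, mul_inv_cancel₀ hα, one_smul] at h1

/-- If `D` is regular and self-adjoint, then so is `α D` for `α > 0`. -/
theorem IsRegularSelfAdjoint.smul {D : E →ₗ.[ℂ] E} (hD : IsRegularSelfAdjoint C D) {α : ℝ}
    (hα : 0 < α) : IsRegularSelfAdjoint C (α • D) := by
  have hadj : adjoint C (α • D) = α • D := by
    refine LinearPMap.eq_of_eq_graph (Submodule.ext ?_)
    rintro ⟨x, y⟩
    rw [mem_graph_adjoint (D := α • D) hD.dense_domain, mem_smul_graph hα.ne', hD.mem_graph_iff]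
    refine forall_congr' fun ψ => ?_
    rw [LinearPMap.smul_apply, CStarModule.inner_smul_left_real,
      CStarModule.inner_smul_right_real, eq_inv_smul_iff₀ hα.ne']
  have hsolve : ∀ z : E, ∃ x y w : E, (x, y) ∈ (α • D).graph ∧ (y, w) ∈ (α • D).graph ∧
      x + w = z := by
    set R := hD.oneAddSqInv with hR
    have h1R : 0 ≤ 1 - R := by
      have h : 1 - R = star (1 - R) * (1 - R) + star hD.mulOneAddSqInv * hD.mulOneAddSqInv := by
        rw [hD.isSelfAdjoint_mulOneAddSqInv.star_eq, star_sub, star_one,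
          hD.isSelfAdjoint_oneAddSqInv.star_eq, hD.mulOneAddSqInv_mul_self, ← hR]
        noncomm_ring
      rw [h]
      exact add_nonneg (star_mul_self_nonneg _) (star_mul_self_nonneg _)
    have hunit : IsUnit (R + (α ^ 2) • (1 - R)) := by
      set m : ℝ := min 1 (α ^ 2) with hm
      have hm0 : 0 < m := lt_min one_pos (by positivity)
      have hle : algebraMap ℝ (Adjointable C E) m ≤ R + (α ^ 2) • (1 - R) := by
        have e : R + (α ^ 2) • (1 - R) - algebraMap ℝ (Adjointable C E) m =
            (1 - m) • R + (α ^ 2 - m) • (1 - R) := by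
          rw [Algebra.algebraMap_eq_smul_one]
          module
        rw [← sub_nonneg, e]
        exact add_nonneg (smul_nonneg (sub_nonneg.2 (min_le_left _ _)) hD.oneAddSqInv_nonneg)
          (smul_nonneg (sub_nonneg.2 (min_le_right _ _)) h1R)
      have hp : IsStrictlyPositive (algebraMap ℝ (Adjointable C E) m) := by
        refine IsStrictlyPositive.iff_of_unital.2 ⟨?_, ?_⟩
        · rw [Algebra.algebraMap_eq_smul_one]
          exact smul_nonneg hm0.le zero_le_one
        · exact (IsUnit.mk0 m hm0.ne').map _
      exact CStarAlgebra.isUnit_of_le _ hle hp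
    obtain ⟨V, hV⟩ := hunit.exists_right_inv
    intro z
    have hVz : R (V z) + (α ^ 2) • (V z - R (V z)) = z := by
      have h := congrArg (fun T : Adjointable C E => T z) hV
      exact h
    refine ⟨R (V z), α • hD.mulOneAddSqInv (V z), α • (α • (V z - R (V z))),
      smul_mem_graph (hD.oneAddSqInv_mem _) α, ?_, ?_⟩
    · rw [mem_smul_graph hα.ne', smul_smul, inv_mul_cancel₀ hα.ne', one_smul]
      have h := D.graph.smul_mem (α : ℂ) (hD.mulOneAddSqInv_mem (V z))
      simpa using h
    · rw [smul_smul, ← pow_two]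
      exact hVz
  refine { dense_domain := hD.dense_domain, smul_mem := hD.smul_mem, map_smul := fun a ψ => ?_,
           isClosed_graph := ?_, dense_domain_adjoint := ?_, dense_range := ?_,
           adjoint_eq := hadj }
  · change α • D ⟨a • (ψ : E), _⟩ = a • (α • D ψ)
    rw [hD.map_smul a ψ]
    refine ext_inner_left C fun z => ?_
    simp [mul_smul_comm]
  · have h : ((α • D).graph : Set (E × E)) =
        (fun p : E × E => (p.1, α⁻¹ • p.2)) ⁻¹' (D.graph : Set (E × E)) := by
      ext ⟨x, y⟩
      exact mem_smul_graph hα.ne'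
    rw [h]
    exact hD.isClosed_graph.preimage (by fun_prop)
  · rw [hadj]
    exact hD.dense_domain
  · rw [hadj]
    intro z
    refine subset_closure ?_
    obtain ⟨x, y, w, h1, h2, h3⟩ := hsolve z
    obtain ⟨ψ, rfl, rfl⟩ := (LinearPMap.mem_graph_iff _).1 h1
    obtain ⟨φ, h4, rfl⟩ := (LinearPMap.mem_graph_iff _).1 h2
    replace h4 : (φ : E) = (α • D) ψ := h4
    have h5 : (α • D) ψ ∈ (α • D).domain := by rw [← h4]; exact φ.2
    refine ⟨ψ, h5, ?_⟩
    rw [← h3]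
    congr 2
    exact Subtype.ext h4.symm

end Smul

/-! `ℤ/2`-gradings, odd operators and the graded commutator. -/

section Grading

/-- A `ℤ/2`-grading of a Hilbert C⋆-module `E` over a C⋆-algebra `C`: an involutive
`⋆`-automorphism of `C` together with a compatible linear involution of `E`. Even and odd
elements are the `±1`-eigenvectors of these involutions. -/
structure Grading (C E : Type*) [NonUnitalCStarAlgebra C] [PartialOrder C]
    [NormedAddCommGroup E] [NormedSpace ℂ E] [SMul C E] [CStarModule C E] where
  /-- The grading automorphism of the C⋆-algebra. -/
  alg : C ≃⋆ₐ[ℂ] C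
  alg_alg : ∀ a, alg (alg a) = a
  /-- The grading operator of the module. -/
  op : E →ₗ[ℂ] E
  op_op : ∀ x, op (op x) = x
  op_smul : ∀ (a : C) (x : E), op (a • x) = alg a • op x
  inner_op : ∀ x y : E, ⟪op x, op y⟫_C = alg ⟪x, y⟫_C

variable {C E : Type*} [NonUnitalCStarAlgebra C] [PartialOrder C] [StarOrderedRing C]
  [NormedAddCommGroup E] [NormedSpace ℂ E] [SMul C E] [CStarModule C E]

namespace Grading

variable (γ : Grading C E)

/-- An unbounded operator is odd when it anticommutes with the grading operator (which
preserves its domain). -/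
def IsOdd (D : E →ₗ.[ℂ] E) : Prop :=
  ∀ ψ : D.domain, ∃ h : γ.op ψ ∈ D.domain, D ⟨γ.op ψ, h⟩ = -γ.op (D ψ)

theorem norm_op (x : E) : ‖γ.op x‖ = ‖x‖ := by
  have h : ‖γ.op x‖ ^ 2 = ‖x‖ ^ 2 := by
    rw [CStarModule.norm_sq_eq C, CStarModule.norm_sq_eq C, γ.inner_op]
    exact NonUnitalStarAlgHom.norm_map γ.alg γ.alg.injective _
  exact (sq_eq_sq₀ (norm_nonneg _) (norm_nonneg _)).1 h

/-- The grading operator as a bounded operator. -/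
def opL : E →L[ℂ] E := γ.op.mkContinuous 1 fun x => by rw [γ.norm_op, one_mul]

theorem inner_op_left (x y : E) : ⟪γ.op x, y⟫_C = γ.alg ⟪x, γ.op y⟫_C := by
  rw [← γ.inner_op, γ.op_op]

/-- The grading automorphism `T ↦ γ T γ` of `End_C(E)`. -/
def conj (T : Adjointable C E) : Adjointable C E :=
  Adjointable.mk (γ.opL ∘L T.toCLM ∘L γ.opL) (γ.opL ∘L (star T).toCLM ∘L γ.opL) fun x y => by
    change ⟪γ.op (T (γ.op x)), y⟫_C = ⟪x, γ.op (star T (γ.op y))⟫_C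
    rw [γ.inner_op_left, T.inner_left, ← γ.inner_op, γ.op_op]

theorem conj_apply (T : Adjointable C E) (x : E) : γ.conj T x = γ.op (T (γ.op x)) := rfl

/-- The even part of `T`. -/
def even (T : Adjointable C E) : Adjointable C E := (1 / 2 : ℂ) • (T + γ.conj T)

/-- The odd part of `T`. -/
def odd (T : Adjointable C E) : Adjointable C E := (1 / 2 : ℂ) • (T - γ.conj T)

/-- The graded commutator: the bilinear operation that equals
`S T - (-1) ^ (deg S * deg T) T S` on homogeneous operators. -/
def commutator (S T : Adjointable C E) : Adjointable C E :=
  (γ.even S * γ.even T - γ.even T * γ.even S) + (γ.even S * γ.odd T - γ.odd T * γ.even S) +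
    (γ.odd S * γ.even T - γ.even T * γ.odd S) + (γ.odd S * γ.odd T + γ.odd T * γ.odd S)

end Grading

end Grading

end

end HilbertModule

/-!
The bounded transforms of odd operators are odd, so the graded commutator of `F_D` and `F_S` is the
anticommutator `{F_D, F_S}`. Write `T = (1 + D²)^(-1/2)`. The bound on `{D, S}` is carried to
`{F_D, S}` and then to `{F_D, F_S}` by means of the integral formula

`F_D = (2 / π) ∫ s in (0, ∞), D (1 + s² + D²)⁻¹ = (2 / π) ∫ s in (0, ∞), F_D T (1 + s² T²)⁻¹`.

For `u = (1 + s² + D²)⁻¹ x` with `x` in the domain of `S`, both `u` and `D u` lie in the domain of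
`D`, hence in that of `S`, and
`⟪S x, D u⟫ + ⟪D u, S x⟫` is `1 + s²` times the form of `{D, S}` at `u` plus this form at `D u`.
It is therefore at least `-c ⟪x, (1 + D²)^(1/2) u⟫`, and integration over `s` gives
`⟪S x, F_D x⟫ + ⟪F_D x, S x⟫ ≥ -c ⟪x, x⟫` (`form_boundedTransform_nonneg`). No core of `S` is
involved: the bound holds on the whole domain of `S`. The same argument applied to `S` and
the bounded operator `F_D` gives `{F_D, F_S} ≥ -c (1 + S²)^(-1/2) ≥ -c`
(`form_boundedTransform_right_nonneg`).

The integral is only needed in the weak form of `nonneg_of_forall_invOneAddSq`: the integral of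
`T (1 + s² T²)⁻¹` over `0 ≤ s ≤ N` is `arctan (N T)`, which converges strongly to `π / 2` because
`T` is positive with dense range. An inequality between `C`-valued quadratic forms is turned into
one in the C⋆-algebra of adjointable operators by `Adjointable.nonneg_of_inner_nonneg`.

Finally, `α S` satisfies the hypothesis with `α c` in place of `c`, so `{F_D, F_{α S}} ≥ -α c`, and
`α` can be chosen such that `α c ≤ κ`.
-/

namespace HilbertModule

open scoped InnerProductSpace
open MeasureTheory

noncomputable section

set_option linter.unusedSectionVars false

variable {C E : Type*} [NonUnitalCStarAlgebra C] [PartialOrder C] [StarOrderedRing C]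
  [NormedAddCommGroup E] [NormedSpace ℂ E] [SMul C E] [CStarModule C E]

/-! ### The order of the adjointable operators -/

/-- An adjointable operator with nonnegative `C`-valued quadratic form is nonnegative in the order
of the C⋆-algebra `End_C(E)`: its negative part vanishes. -/
theorem Adjointable.nonneg_of_inner_nonneg [CompleteSpace E] {X : Adjointable C E}
    (hX : IsSelfAdjoint X) (h : ∀ x : E, 0 ≤ ⟪x, X x⟫_C) : 0 ≤ X := by
  rw [← CFC.negPart_eq_zero_iff X hX]
  have hN : 0 ≤ X⁻ := CFC.negPart_nonneg X
  have hXN : X * X⁻ = -(X⁻ * X⁻) := by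
    calc X * X⁻ = (X⁺ - X⁻) * X⁻ := by rw [CFC.posPart_sub_negPart X hX]
      _ = -(X⁻ * X⁻) := by rw [sub_mul, CFC.posPart_mul_negPart, zero_sub]
  set N := X⁻
  have hNs : star N = N := (IsSelfAdjoint.of_nonneg hN).star_eq
  set r := CFC.sqrt N
  have hrr : r * r = N := CFC.sqrt_mul_sqrt_self N hN
  have hrs : star r = r := (IsSelfAdjoint.of_nonneg (CFC.sqrt_nonneg N)).star_eq
  ext z
  -- `⟪N z, X N z⟫ = -⟪√N N z, √N N z⟫` is both nonnegative and nonpositive.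
  have e1 : ⟪N z, X (N z)⟫_C = -⟪r (N z), r (N z)⟫_C := by
    rw [← Adjointable.mul_apply X N, hXN, r.inner_left, hrs, ← Adjointable.mul_apply r r, hrr]
    simp
  have e2 : ⟪r (N z), r (N z)⟫_C = 0 := by
    refine le_antisymm ?_ CStarModule.inner_self_nonneg
    rw [← neg_nonneg, ← e1]
    exact h _
  have e3 : N (N z) = 0 := by
    rw [← hrr, Adjointable.mul_apply, hrr, CStarModule.inner_self.1 e2, map_zero]
  rw [Adjointable.zero_apply, ← CStarModule.inner_self (A := C), N.inner_left, hNs, e3,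
    CStarModule.inner_zero_right]

/-- The continuous real-linear map `y ↦ ⟪u, y⟫ + ⟪y, u⟫`. -/
def symmInner (u : E) : E →L[ℝ] C :=
  (CStarModule.innerSL u).restrictScalars ℝ +
    ((starL' ℝ : C ≃L[ℝ] C) : C →L[ℝ] C) ∘L (CStarModule.innerSL u).restrictScalars ℝ

theorem symmInner_apply (u y : E) : symmInner u y = ⟪u, y⟫_C + ⟪y, u⟫_C := by
  rw [← CStarModule.star_inner u y]
  rfl

variable [CompleteSpace E]

/-! ### An integral approximation of the identity -/

/-- The bounded operator `(1 + s² T²)⁻¹`, for self-adjoint `T`, by functional calculus. -/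
def invOneAddSq (T : Adjointable C E) (s : ℝ) : Adjointable C E :=
  cfc (fun t : ℝ => (1 + (s * t) ^ 2)⁻¹) T

theorem invOneAddSq_add {T : Adjointable C E} (hT : IsSelfAdjoint T) (s : ℝ) :
    invOneAddSq T s + (s ^ 2) • (T * (T * invOneAddSq T s)) = 1 := by
  have hne : ∀ t : ℝ, 1 + (s * t) ^ 2 ≠ 0 := fun t => by positivity
  have hc : Continuous fun t : ℝ => (1 + (s * t) ^ 2)⁻¹ :=
    Continuous.inv₀ (by fun_prop) hne
  have h1 : T * T + 0 = cfc (fun t : ℝ => t * t) T := by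
    rw [cfc_mul (fun t : ℝ => t) (fun t : ℝ => t) T (by fun_prop) (by fun_prop), cfc_id' ℝ T,
      add_zero]
  rw [add_zero] at h1
  rw [invOneAddSq, ← mul_assoc, h1, ← cfc_mul _ _ T (by fun_prop) hc.continuousOn,
    ← cfc_smul (s ^ 2) _ T (by fun_prop), ← cfc_add (a := T) _ _ hc.continuousOn (by fun_prop),
    ← cfc_one ℝ T]
  refine cfc_congr fun t _ => ?_
  have := hne t
  simp only [smul_eq_mul, Pi.one_apply]
  field_simp

theorem integral_mul_inv_one_add_sq (t N : ℝ) :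
    ∫ s in (0 : ℝ)..N, t * (1 + (s * t) ^ 2)⁻¹ = Real.arctan (N * t) := by
  have hc : Continuous fun s : ℝ => t * (1 + (s * t) ^ 2)⁻¹ :=
    continuous_const.mul (Continuous.inv₀ (by fun_prop) fun s => by positivity)
  rw [intervalIntegral.integral_eq_sub_of_hasDerivAt (f := fun s => Real.arctan (s * t))
    (fun s _ => ?_) (hc.intervalIntegrable _ _)]
  · simp
  · refine ((hasDerivAt_id' s).mul_const t).arctan.congr_deriv ?_
    ring

theorem mul_pi_div_two_sub_arctan_le {t N : ℝ} (ht : 0 ≤ t) (hN : 0 < N) :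
    t * (Real.pi / 2 - Real.arctan (N * t)) ≤ 1 / N := by
  rcases ht.eq_or_lt with rfl | ht
  · simp [hN.le]
  have hNt : 0 < N * t := by positivity
  rw [← Real.arctan_inv_of_pos hNt]
  have h1 : Real.arctan (N * t)⁻¹ ≤ (N * t)⁻¹ := by
    have := Real.le_tan (Real.arctan_nonneg.2 (inv_nonneg.2 hNt.le))
      (Real.arctan_lt_pi_div_two (N * t)⁻¹)
    rwa [Real.tan_arctan] at this
  calc t * Real.arctan (N * t)⁻¹ ≤ t * (N * t)⁻¹ := by gcongr
    _ = 1 / N := by field_simp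

/-- The operators `arctan ((n + 1) T)` converge strongly to `π / 2`, because they are uniformly bounded
and converge in norm after multiplication by `T`, whose range is dense. -/
theorem tendsto_cfc_arctan {T : Adjointable C E} (hT : 0 ≤ T) (hd : Dense (Set.range T)) (x : E) :
    Filter.Tendsto (fun n : ℕ => cfc (fun t : ℝ => Real.arctan (((n : ℝ) + 1) * t)) T x)
      Filter.atTop (nhds ((Real.pi / 2) • x)) := by
  have hTs : IsSelfAdjoint T := .of_nonneg hT
  set H : ℕ → Adjointable C E := fun n =>
    cfc (fun t : ℝ => Real.pi / 2 - Real.arctan (((n : ℝ) + 1) * t)) T with hH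
  have hac : ∀ n : ℕ, Continuous fun t : ℝ => Real.arctan (((n : ℝ) + 1) * t) := fun n =>
    Real.continuous_arctan.comp (by fun_prop)
  have hsub : ∀ n, H n = (Real.pi / 2) • (1 : Adjointable C E) -
      cfc (fun t : ℝ => Real.arctan (((n : ℝ) + 1) * t)) T := fun n => by
    simp only [hH]
    rw [cfc_sub _ _ T (by fun_prop) (hac n).continuousOn, cfc_const _ T,
      Algebra.algebraMap_eq_smul_one]
  have hb : ∀ n, ‖H n‖ ≤ Real.pi := fun n => by
    refine norm_cfc_le Real.pi_pos.le fun t _ => ?_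
    rw [Real.norm_eq_abs, abs_le]
    have h1 := Real.arctan_lt_pi_div_two (((n : ℝ) + 1) * t)
    have h2 := Real.neg_pi_div_two_lt_arctan (((n : ℝ) + 1) * t)
    constructor <;> linarith [Real.pi_pos]
  have hbT : ∀ n, ‖H n * T‖ ≤ 1 / ((n : ℝ) + 1) := fun n => by
    have e : H n * T =
        cfc (fun t : ℝ => t * (Real.pi / 2 - Real.arctan (((n : ℝ) + 1) * t))) T := by
      rw [cfc_mul (fun t : ℝ => t) (fun t : ℝ => Real.pi / 2 - Real.arctan (((n : ℝ) + 1) * t)) T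
        (by fun_prop) (continuous_const.sub (hac n)).continuousOn, cfc_id' ℝ T]
      exact ((Commute.refl T).cfc_real _).eq
    rw [e]
    refine norm_cfc_le (by positivity) fun t ht => ?_
    have ht0 : 0 ≤ t := spectrum_nonneg_of_nonneg hT ht
    rw [Real.norm_of_nonneg (mul_nonneg ht0
      (sub_nonneg.2 (Real.arctan_lt_pi_div_two _).le))]
    exact mul_pi_div_two_sub_arctan_le ht0 (by positivity)
  have h0 : Filter.Tendsto (fun n => H n x) Filter.atTop (nhds 0) := by
    rw [Metric.tendsto_atTop]
    intro ε hε
    obtain ⟨_, ⟨z, rfl⟩, hz⟩ := hd.exists_dist_lt x (show 0 < ε / (2 * Real.pi) by positivity)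
    obtain ⟨k, hk⟩ := exists_nat_gt (2 * (‖z‖ + 1) / ε)
    refine ⟨k, fun n hn => ?_⟩
    have e : H n x = H n (x - T z) + (H n * T) z := by
      rw [Adjointable.mul_apply, ← ContinuousLinearMap.map_add, sub_add_cancel]
    have h1 : ‖H n (x - T z)‖ ≤ Real.pi * (ε / (2 * Real.pi)) := by
      refine ((H n).le_opNorm _).trans (mul_le_mul (hb n) ?_ (norm_nonneg _) Real.pi_pos.le)
      rw [← dist_eq_norm]
      exact hz.le
    have h2 : ‖(H n * T) z‖ ≤ 1 / ((n : ℝ) + 1) * ‖z‖ :=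
      ((H n * T).le_opNorm _).trans (by gcongr; exact hbT n)
    have h3 : 1 / ((n : ℝ) + 1) * ‖z‖ < ε / 2 := by
      have hkn : (k : ℝ) ≤ n := by exact_mod_cast hn
      have : 2 * (‖z‖ + 1) / ε < (n : ℝ) + 1 := by linarith
      rw [div_lt_iff₀ hε] at this
      rw [one_div, inv_mul_lt_iff₀ (by positivity)]
      linarith
    have h4 : Real.pi * (ε / (2 * Real.pi)) = ε / 2 := by
      field_simp
    rw [dist_zero_right, e]
    refine (norm_add_le _ _).trans_lt ?_
    linarith
  have h5 := (tendsto_const_nhds (x := (Real.pi / 2) • x)).sub h0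
  rw [sub_zero] at h5
  refine h5.congr fun n => ?_
  rw [hsub, Adjointable.sub_apply]
  have : ((Real.pi / 2) • (1 : Adjointable C E)) x = (Real.pi / 2) • x := rfl
  rw [this, sub_sub_cancel]

/-- Up to the factor `π / 2`, every vector `x` is a limit of the integrals of the vectors
`T (1 + s² T²)⁻¹ x` over `0 ≤ s ≤ n + 1`; so a continuous real-linear map that is nonnegative on
these vectors is nonnegative on `x`. -/
theorem nonneg_of_forall_invOneAddSq {T : Adjointable C E} (hT : 0 ≤ T)
    (hd : Dense (Set.range T)) (m : E →L[ℝ] C) (x : E)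
    (h : ∀ s : ℝ, 0 ≤ m (T (invOneAddSq T s x))) : 0 ≤ m x := by
  have hTs : IsSelfAdjoint T := .of_nonneg hT
  let L : Adjointable C E →L[ℝ] C :=
    m ∘L (ContinuousLinearMap.apply ℂ E x ∘L
      (adjointables C E).toSubmodule.subtypeL).restrictScalars ℝ
  have hL : ∀ X : Adjointable C E, L X = m (X x) := fun X => rfl
  have hker : ∀ s : ℝ, T * invOneAddSq T s = cfc (fun t : ℝ => t * (1 + (s * t) ^ 2)⁻¹) T := by
    intro s
    rw [cfc_mul (fun t : ℝ => t) (fun t : ℝ => (1 + (s * t) ^ 2)⁻¹) T (by fun_prop)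
      (Continuous.inv₀ (by fun_prop) fun t => by positivity).continuousOn, cfc_id' ℝ T]
    rfl
  have hcont : Continuous (Function.uncurry fun s t : ℝ => t * (1 + (s * t) ^ 2)⁻¹) :=
    continuous_snd.mul (Continuous.inv₀ (by fun_prop) fun p => by positivity)
  -- `‖1‖` is kept in the bound because `E = 0` is allowed.
  have hbd : ∀ s : ℝ, ∀ t ∈ spectrum ℝ T,
      ‖t * (1 + (s * t) ^ 2)⁻¹‖ ≤ ‖T‖ * ‖(1 : Adjointable C E)‖ := by
    intro s t ht
    rw [norm_mul, norm_inv]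
    have h1 : ‖t‖ ≤ ‖T‖ * ‖(1 : Adjointable C E)‖ := spectrum.norm_le_norm_mul_of_mem ht
    have h2 : 1 ≤ ‖1 + (s * t) ^ 2‖ := by
      rw [Real.norm_of_nonneg (by positivity)]
      nlinarith [sq_nonneg (s * t)]
    calc _ ≤ ‖t‖ * 1 := by gcongr; exact inv_le_one_of_one_le₀ h2
      _ ≤ _ := by rwa [mul_one]
  have key : ∀ n : ℕ, 0 ≤ m (cfc (fun t : ℝ => Real.arctan (((n : ℝ) + 1) * t)) T x) := by
    intro n
    have hn : (0 : ℝ) ≤ (n : ℝ) + 1 := by positivity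
    have hfin : HasFiniteIntegral (fun _ : ℝ => ‖T‖ * ‖(1 : Adjointable C E)‖)
        (volume.restrict (Set.Ioc (0 : ℝ) ((n : ℝ) + 1))) :=
      (integrable_const _).hasFiniteIntegral
    have e := cfc_setIntegral (𝕜 := ℝ) measurableSet_Ioc (fun s t : ℝ => t * (1 + (s * t) ^ 2)⁻¹)
      (fun _ => ‖T‖ * ‖(1 : Adjointable C E)‖) T hcont.continuousOn
      (Filter.Eventually.of_forall hbd) hfin
    have hi := integrableOn_cfc (𝕜 := ℝ) measurableSet_Ioc
      (fun s t : ℝ => t * (1 + (s * t) ^ 2)⁻¹)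
      (fun _ => ‖T‖ * ‖(1 : Adjointable C E)‖) T hcont.continuousOn
      (Filter.Eventually.of_forall hbd) hfin
    simp only [← intervalIntegral.integral_of_le hn, integral_mul_inv_one_add_sq] at e
    rw [← hL, e, intervalIntegral.integral_of_le hn, ← L.integral_comp_comm hi]
    refine integral_nonneg fun s => ?_
    have := h s
    rw [← Adjointable.mul_apply, hker] at this
    exact this
  have hlim := ge_of_tendsto' ((m.continuous.tendsto _).comp (tendsto_cfc_arctan hT hd x)) key
  rw [map_smul] at hlim
  have := smul_nonneg (inv_nonneg.2 (show (0 : ℝ) ≤ Real.pi / 2 by positivity)) hlim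
  rwa [smul_smul, inv_mul_cancel₀ (by positivity), one_smul] at this

/-! ### The equation `(1 + s² + D²) u = x` -/

namespace IsRegularSelfAdjoint

variable {D : E →ₗ.[ℂ] E}

theorem isSelfAdjoint_boundedTransform (hD : IsRegularSelfAdjoint C D) :
    IsSelfAdjoint hD.boundedTransform := by
  refine Adjointable.eq_star_of_inner fun x y => ?_
  have hd := hD.dense_range_oneAddSqInvSqrt
  refine hd.induction (P := fun y => ⟪hD.boundedTransform x, y⟫_C = ⟪x, hD.boundedTransform y⟫_C)
    ?_ ?_ y
  · rintro _ ⟨w, rfl⟩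
    have h := hD.symmetric (hD.boundedTransform_mem x) (hD.boundedTransform_mem w)
    rw [h, ← Adjointable.mul_apply, ← hD.commute_boundedTransform.eq, Adjointable.mul_apply,
      Adjointable.inner_left, hD.isSelfAdjoint_oneAddSqInvSqrt.star_eq]
  · exact isClosed_eq (CStarModule.continuous_inner.comp
        (continuous_const.prodMk continuous_id)) (CStarModule.continuous_inner.comp
        (continuous_const.prodMk hD.boundedTransform.toCLM.continuous))

theorem boundedTransform_mul_self (hD : IsRegularSelfAdjoint C D) :
    hD.boundedTransform * hD.boundedTransform =
      1 - hD.oneAddSqInvSqrt * hD.oneAddSqInvSqrt := by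
  set F := hD.boundedTransform
  set T := hD.oneAddSqInvSqrt
  have h1 : T * T * (F * F) = T * T * (1 - T * T) := by
    have hc : T * F = F * T := hD.commute_boundedTransform.eq
    have e : T * T * (F * F) = F * T * (F * T) := by
      calc T * T * (F * F) = T * (T * F) * F := by simp only [mul_assoc]
        _ = (T * F) * (T * F) := by nth_rw 1 [hc]; simp only [mul_assoc]
        _ = F * T * (F * T) := by rw [hc]
    rw [e, hD.boundedTransform_mul_oneAddSqInvSqrt, hD.mulOneAddSqInv_mul_self,
      hD.oneAddSqInvSqrt_mul_self, mul_sub, mul_one]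
  ext z
  have h2 := congrArg (fun X : Adjointable C E => X z) h1
  exact hD.oneAddSqInvSqrt_injective (hD.oneAddSqInvSqrt_injective h2)

/-- With `T = (1 + D²)^(-1/2)` and `Q = (1 + s² T²)⁻¹`, the vector `u = T² Q x` solves
`(1 + s² + D²) u = x`; here `D u` and `D² u` are expressed by means of the bounded transform. -/
theorem smul_add_boundedTransform_sq (hD : IsRegularSelfAdjoint C D) (s : ℝ) (x : E) :
    (1 + s ^ 2) • hD.oneAddSqInvSqrt (hD.oneAddSqInvSqrt (invOneAddSq hD.oneAddSqInvSqrt s x)) +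
      hD.boundedTransform (hD.boundedTransform (invOneAddSq hD.oneAddSqInvSqrt s x)) = x := by
  have h1 := congrArg (fun X : Adjointable C E => X x)
    (invOneAddSq_add hD.isSelfAdjoint_oneAddSqInvSqrt s)
  have h2 := congrArg (fun X : Adjointable C E => X (invOneAddSq hD.oneAddSqInvSqrt s x))
    hD.boundedTransform_mul_self
  simp only [Adjointable.add_apply, Adjointable.mul_apply, Adjointable.sub_apply,
    Adjointable.one_apply] at h1 h2
  have h3 : ((s ^ 2) • (hD.oneAddSqInvSqrt * (hD.oneAddSqInvSqrt *
      invOneAddSq hD.oneAddSqInvSqrt s))) x = (s ^ 2) • hD.oneAddSqInvSqrt (hD.oneAddSqInvSqrt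
        (invOneAddSq hD.oneAddSqInvSqrt s x)) := rfl
  rw [h3] at h1
  rw [h2, add_smul, one_smul]
  nth_rw 5 [← h1]
  abel

theorem oneAddSqInvSqrt_boundedTransform (hD : IsRegularSelfAdjoint C D) (z : E) :
    hD.oneAddSqInvSqrt (hD.boundedTransform z) = hD.boundedTransform (hD.oneAddSqInvSqrt z) := by
  rw [← Adjointable.mul_apply, hD.commute_boundedTransform.eq, Adjointable.mul_apply]

/-! ### Lower bounds for anticommutators -/

/-- A lower bound on the anticommutator of `D` and a symmetric operator `S`, in the sense of
quadratic forms, passes to the bounded transform of `D`. The hypothesis is the bound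
`{D, S} ≥ -c (1 + D²)^(1/2)`, evaluated at the vectors `(1 + D²)^(-1/2) z`. -/
theorem form_boundedTransform_nonneg {S : E →ₗ.[ℂ] E} (hD : IsRegularSelfAdjoint C D)
    (hS : IsRegularSelfAdjoint C S) (hdom : D.domain ≤ S.domain) {c : ℝ}
    (h : ∀ z y : E, (hD.oneAddSqInvSqrt z, y) ∈ S.graph →
      0 ≤ ⟪y, hD.boundedTransform z⟫_C + ⟪hD.boundedTransform z, y⟫_C +
        c • ⟪hD.oneAddSqInvSqrt z, z⟫_C)
    {x y : E} (hxy : (x, y) ∈ S.graph) :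
    0 ≤ ⟪y, hD.boundedTransform x⟫_C + ⟪hD.boundedTransform x, y⟫_C + c • ⟪x, x⟫_C := by
  set T := hD.oneAddSqInvSqrt with hT
  set F := hD.boundedTransform with hF
  let m : E →L[ℝ] C := symmInner y ∘L F.toCLM.restrictScalars ℝ +
    c • (CStarModule.innerSL x).restrictScalars ℝ
  have hm : ∀ z, m z = ⟪y, F z⟫_C + ⟪F z, y⟫_C + c • ⟪x, z⟫_C := fun z => by
    rw [← symmInner_apply]
    rfl
  rw [← hm]
  refine nonneg_of_forall_invOneAddSq hD.oneAddSqInvSqrt_nonneg hD.dense_range_oneAddSqInvSqrt m x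
    fun s => ?_
  rw [hm, ← hT]
  set q := invOneAddSq T s x with hq
  have hx : (1 + s ^ 2) • T (T q) + F (F q) = x := hD.smul_add_boundedTransform_sq s x
  have hgraph : ∀ z, ∃ w, (T z, w) ∈ S.graph := fun z =>
    ⟨_, S.mem_graph ⟨T z, hdom (hD.oneAddSqInvSqrt_mem_domain z)⟩⟩
  obtain ⟨a, ha⟩ := hgraph (T q)
  obtain ⟨b, hb⟩ := hgraph (F q)
  have hTF : T (F q) = F (T q) := hD.oneAddSqInvSqrt_boundedTransform q
  have p1 := smul_nonneg (show (0 : ℝ) ≤ 1 + s ^ 2 by positivity) (h _ _ ha)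
  have p2 := h _ _ hb
  refine (add_nonneg p1 p2).trans_eq ?_
  -- Move `S` from `x` to `F T q = D T² q`, and expand `x = (1 + s² + D²) T² q`.
  have e1 : ⟪y, F (T q)⟫_C = (1 + s ^ 2) • ⟪a, F (T q)⟫_C + ⟪F (F q), b⟫_C := by
    rw [← hTF, hS.symmetric hxy hb, ← hx, CStarModule.inner_add_left,
      CStarModule.inner_smul_left_real, hS.symmetric ha hb]
  have e2 : ⟪F (T q), y⟫_C = (1 + s ^ 2) • ⟪F (T q), a⟫_C + ⟪b, F (F q)⟫_C := by
    rw [← CStarModule.star_inner, e1, star_add, star_smul, CStarModule.star_inner,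
      CStarModule.star_inner]
    simp
  have e3 : ⟪T (F q), F q⟫_C = ⟪F (F q), T q⟫_C := by
    rw [T.inner_left, hD.isSelfAdjoint_oneAddSqInvSqrt.star_eq, hTF,
      Adjointable.inner_left F (F q), hD.isSelfAdjoint_boundedTransform.star_eq]
  have e4 : ⟪x, T q⟫_C = (1 + s ^ 2) • ⟪T (T q), T q⟫_C + ⟪F (F q), T q⟫_C := by
    conv_lhs => rw [← hx]
    rw [CStarModule.inner_add_left, CStarModule.inner_smul_left_real]
  rw [e1, e2, e3, e4]
  module

/-- A lower bound `{A, S} ≥ -c` on the anticommutator of a bounded operator `A` with `S`, in the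
sense of quadratic forms, gives `{A, F_S} ≥ -c (1 + S²)^(-1/2)`. -/
theorem form_boundedTransform_right_nonneg {S : E →ₗ.[ℂ] E} (hS : IsRegularSelfAdjoint C S)
    {A : Adjointable C E} (hA : IsSelfAdjoint A) {c : ℝ}
    (h : ∀ x y : E, (x, y) ∈ S.graph → 0 ≤ ⟪y, A x⟫_C + ⟪A x, y⟫_C + c • ⟪x, x⟫_C) (x : E) :
    0 ≤ ⟪A x, hS.boundedTransform x⟫_C + ⟪hS.boundedTransform x, A x⟫_C +
      c • ⟪x, hS.oneAddSqInvSqrt x⟫_C := by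
  set T := hS.oneAddSqInvSqrt with hT
  set F := hS.boundedTransform with hF
  let m : E →L[ℝ] C := symmInner (A x) ∘L F.toCLM.restrictScalars ℝ +
    c • ((CStarModule.innerSL x).restrictScalars ℝ ∘L T.toCLM.restrictScalars ℝ)
  have hm : ∀ z, m z = ⟪A x, F z⟫_C + ⟪F z, A x⟫_C + c • ⟪x, T z⟫_C := fun z => by
    rw [← symmInner_apply]
    rfl
  rw [← hm]
  refine nonneg_of_forall_invOneAddSq hS.oneAddSqInvSqrt_nonneg hS.dense_range_oneAddSqInvSqrt m x
    fun s => ?_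
  rw [hm, ← hT]
  set q := invOneAddSq T s x with hq
  have hx : (1 + s ^ 2) • T (T q) + F (F q) = x := hS.smul_add_boundedTransform_sq s x
  have hTF : T (F q) = F (T q) := hS.oneAddSqInvSqrt_boundedTransform q
  have ha : (T (T q), F (T q)) ∈ S.graph := hS.boundedTransform_mem (T q)
  have hb : (F (T q), F (F q)) ∈ S.graph := hTF ▸ hS.boundedTransform_mem (F q)
  have p1 := smul_nonneg (show (0 : ℝ) ≤ 1 + s ^ 2 by positivity) (h _ _ ha)
  have p2 := h _ _ hb
  refine (add_nonneg p1 p2).trans_eq ?_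
  have hAs : ∀ u v, ⟪A u, v⟫_C = ⟪u, A v⟫_C := fun u v => by rw [A.inner_left, hA.star_eq]
  have e1 : ⟪A x, F (T q)⟫_C = (1 + s ^ 2) • ⟪A (T (T q)), F (T q)⟫_C +
      ⟪F (F q), A (F (T q))⟫_C := by
    rw [hAs, ← hx, CStarModule.inner_add_left, CStarModule.inner_smul_left_real, ← hAs (T (T q))]
  have e2 : ⟪F (T q), A x⟫_C = (1 + s ^ 2) • ⟪F (T q), A (T (T q))⟫_C +
      ⟪A (F (T q)), F (F q)⟫_C := by
    rw [← CStarModule.star_inner, e1, star_add, star_smul, CStarModule.star_inner,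
      CStarModule.star_inner]
    simp
  have e3 : ⟪F (T q), F (T q)⟫_C = ⟪F (F q), T (T q)⟫_C := (hS.symmetric hb ha).symm
  have e4 : ⟪x, T (T q)⟫_C = (1 + s ^ 2) • ⟪T (T q), T (T q)⟫_C + ⟪F (F q), T (T q)⟫_C := by
    conv_lhs => rw [← hx]
    rw [CStarModule.inner_add_left, CStarModule.inner_smul_left_real]
  rw [e1, e2, e3, e4]
  module

theorem oneAddSqInvSqrt_le_one (hD : IsRegularSelfAdjoint C D) : hD.oneAddSqInvSqrt ≤ 1 := by
  have h : ‖hD.oneAddSqInvSqrt‖ ≤ 1 := by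
    have h1 : ‖hD.oneAddSqInvSqrt‖ * ‖hD.oneAddSqInvSqrt‖ ≤ 1 := by
      rw [← CStarRing.norm_star_mul_self, hD.isSelfAdjoint_oneAddSqInvSqrt.star_eq,
        hD.oneAddSqInvSqrt_mul_self]
      exact hD.norm_oneAddSqInv_le
    nlinarith [norm_nonneg hD.oneAddSqInvSqrt]
  have h2 := hD.isSelfAdjoint_oneAddSqInvSqrt.le_algebraMap_norm_self
  refine h2.trans ?_
  rw [Algebra.algebraMap_eq_smul_one]
  exact (smul_le_smul_of_nonneg_right h zero_le_one).trans_eq (one_smul _ _)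

/-- The form bound `{D, S} ≥ -c (1 + D²)^(1/2)` implies `{F_D, F_S} ≥ -c`. -/
theorem neg_smul_one_le_anticommutator {S : E →ₗ.[ℂ] E} (hD : IsRegularSelfAdjoint C D)
    (hS : IsRegularSelfAdjoint C S) (hdom : D.domain ≤ S.domain) {c : ℝ} (hc : 0 ≤ c)
    (h : ∀ z y : E, (hD.oneAddSqInvSqrt z, y) ∈ S.graph →
      0 ≤ ⟪y, hD.boundedTransform z⟫_C + ⟪hD.boundedTransform z, y⟫_C +
        c • ⟪hD.oneAddSqInvSqrt z, z⟫_C) :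
    -(c • (1 : Adjointable C E)) ≤ hD.boundedTransform * hS.boundedTransform +
      hS.boundedTransform * hD.boundedTransform := by
  set F := hD.boundedTransform with hF
  set G := hS.boundedTransform with hG
  set T := hS.oneAddSqInvSqrt with hT
  have hFs : star F = F := hD.isSelfAdjoint_boundedTransform.star_eq
  have hGs : star G = G := hS.isSelfAdjoint_boundedTransform.star_eq
  have hTs : star T = T := hS.isSelfAdjoint_oneAddSqInvSqrt.star_eq
  have key : 0 ≤ F * G + G * F + c • T := by
    refine Adjointable.nonneg_of_inner_nonneg ?_ fun x => ?_
    · rw [IsSelfAdjoint, star_add, star_add, star_mul, star_mul, star_smul, hFs, hGs, hTs,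
        star_trivial, add_comm (G * F)]
    · refine (hS.form_boundedTransform_right_nonneg hD.isSelfAdjoint_boundedTransform
        (fun u v huv => hD.form_boundedTransform_nonneg hS hdom h huv) x).trans_eq ?_
      have e : (F * G + G * F + c • T) x = F (G x) + G (F x) + c • T x := rfl
      rw [e, CStarModule.inner_add_right, CStarModule.inner_add_right,
        CStarModule.inner_smul_right_real, F.inner_left, G.inner_left, hFs, hGs]
  have h1 : c • T ≤ c • (1 : Adjointable C E) :=
    smul_le_smul_of_nonneg_left hS.oneAddSqInvSqrt_le_one hc
  rw [neg_le_iff_add_nonneg]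
  exact key.trans (by gcongr)

end IsRegularSelfAdjoint

/-! ### Odd operators -/

namespace Grading

variable (γ : Grading C E)

theorem conj_mul (X Y : Adjointable C E) : γ.conj (X * Y) = γ.conj X * γ.conj Y := by
  ext x
  simp only [conj_apply, Adjointable.mul_apply, γ.op_op]

theorem conj_star (X : Adjointable C E) : γ.conj (star X) = star (γ.conj X) := by
  refine (Adjointable.eq_star_of_inner fun x y => ?_).symm
  rw [conj_apply, conj_apply, γ.inner_op_left, X.inner_left, ← γ.inner_op, γ.op_op]

theorem conj_nonneg {X : Adjointable C E} (hX : 0 ≤ X) : 0 ≤ γ.conj X := by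
  obtain ⟨Y, rfl⟩ := CStarAlgebra.nonneg_iff_eq_star_mul_self.1 hX
  rw [conj_mul, conj_star]
  exact star_mul_self_nonneg _

variable {γ} {D : E →ₗ.[ℂ] E}

theorem IsOdd.op_mem_graph (h : γ.IsOdd D) {x y : E} (hxy : (x, y) ∈ D.graph) :
    (γ.op x, -γ.op y) ∈ D.graph := by
  obtain ⟨ψ, rfl, rfl⟩ := (LinearPMap.mem_graph_iff D).1 hxy
  obtain ⟨h1, h2⟩ := h ψ
  rw [← h2]
  exact D.mem_graph ⟨_, h1⟩

theorem IsOdd.smul (h : γ.IsOdd D) (α : ℝ) : γ.IsOdd (α • D) := by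
  intro ψ
  obtain ⟨h1, h2⟩ := h ψ
  refine ⟨h1, ?_⟩
  have e : γ.op (α • D ψ) = α • γ.op (D ψ) := γ.opL.map_smul_of_tower α (D ψ)
  rw [LinearPMap.smul_apply, LinearPMap.smul_apply, e, ← smul_neg]
  exact congrArg (α • ·) h2

theorem IsOdd.conj_oneAddSqInv (h : γ.IsOdd D) (hD : IsRegularSelfAdjoint C D) :
    γ.conj hD.oneAddSqInv = hD.oneAddSqInv := by
  ext x
  have h1 := h.op_mem_graph (hD.oneAddSqInv_mem (γ.op x))
  have h2 := D.graph.neg_mem (h.op_mem_graph (hD.mulOneAddSqInv_mem (γ.op x)))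
  rw [conj_apply]
  refine (hD.oneAddSqInv_eq h1 ?_).1.symm
  simpa [γ.op_op] using h2

theorem IsOdd.conj_oneAddSqInvSqrt (h : γ.IsOdd D) (hD : IsRegularSelfAdjoint C D) :
    γ.conj hD.oneAddSqInvSqrt = hD.oneAddSqInvSqrt := by
  refine (CFC.sqrt_unique ?_ (γ.conj_nonneg hD.oneAddSqInvSqrt_nonneg)).symm
  rw [← conj_mul, hD.oneAddSqInvSqrt_mul_self, h.conj_oneAddSqInv]

theorem IsOdd.conj_boundedTransform (h : γ.IsOdd D) (hD : IsRegularSelfAdjoint C D) :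
    γ.conj hD.boundedTransform = -hD.boundedTransform := by
  ext x
  have h1 := h.op_mem_graph (hD.boundedTransform_mem (γ.op x))
  have h2 := congrArg (fun X : Adjointable C E => X x) (h.conj_oneAddSqInvSqrt hD)
  rw [Adjointable.neg_apply, conj_apply, ← neg_eq_iff_eq_neg]
  exact D.mem_graph_snd_inj h1 (hD.boundedTransform_mem x) h2

theorem commutator_eq_of_conj_eq_neg {X Y : Adjointable C E} (hX : γ.conj X = -X)
    (hY : γ.conj Y = -Y) : γ.commutator X Y = X * Y + Y * X := by
  have he : ∀ Z : Adjointable C E, γ.conj Z = -Z → γ.even Z = 0 ∧ γ.odd Z = Z := by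
    intro Z hZ
    rw [even, odd, hZ]
    constructor
    · simp
    · module
  simp [commutator, (he X hX).1, (he X hX).2, (he Y hY).1, (he Y hY).2]

end Grading

end

end HilbertModule

open HilbertModule in
open scoped InnerProductSpace in
theorem mainTheorem10 {C E : Type*} [NonUnitalCStarAlgebra C] [PartialOrder C] [StarOrderedRing C]
    [NormedAddCommGroup E] [NormedSpace ℂ E] [CompleteSpace E] [SMul C E] [CStarModule C E]
    (γ : Grading C E) (D S : E →ₗ.[ℂ] E)
    (hD : IsRegularSelfAdjoint C D) (hS : IsRegularSelfAdjoint C S)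
    (hDodd : γ.IsOdd D) (hSodd : γ.IsOdd S)
    (hdom : D.domain ≤ S.domain) (c : ℝ) (hc : 0 ≤ c)
    (hpos : ∀ ψ : D.domain,
      -(c • ⟪(ψ : E), hD.sqrtOneAddSq ⟨ψ, hD.sqrtOneAddSq_domain.ge ψ.2⟩⟫_C) ≤
        ⟪S ⟨ψ, hdom ψ.2⟩, D ψ⟫_C + ⟪D ψ, S ⟨ψ, hdom ψ.2⟩⟫_C) :
    -(c • (1 : Adjointable C E)) ≤ γ.commutator hD.boundedTransform hS.boundedTransform ∧
    ∀ κ : ℝ, 0 < κ → κ < 2 → ∃ (α : ℝ) (hα : 0 < α),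
      -(κ • (1 : Adjointable C E)) ≤
        γ.commutator hD.boundedTransform (hS.smul hα).boundedTransform := by
  have h : ∀ z y : E, (hD.oneAddSqInvSqrt z, y) ∈ S.graph →
      0 ≤ ⟪y, hD.boundedTransform z⟫_C + ⟪hD.boundedTransform z, y⟫_C +
        c • ⟪hD.oneAddSqInvSqrt z, z⟫_C := by
    intro z y hzy
    have hz := hD.oneAddSqInvSqrt_mem_domain z
    have h1 := hpos ⟨hD.oneAddSqInvSqrt z, hz⟩
    have h2 : hD.sqrtOneAddSq ⟨hD.oneAddSqInvSqrt z, hD.sqrtOneAddSq_domain.ge hz⟩ = z :=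
      hD.oneAddSqInvSqrt_injective (hD.sqrtOneAddSq_apply _)
    have h3 : S ⟨hD.oneAddSqInvSqrt z, hdom hz⟩ = y :=
      S.mem_graph_snd_inj (S.mem_graph _) hzy rfl
    rwa [h2, h3, ← hD.boundedTransform_apply, neg_le_iff_add_nonneg] at h1
  have hF := hDodd.conj_boundedTransform hD
  refine ⟨?_, fun κ hκ _ => ?_⟩
  · rw [Grading.commutator_eq_of_conj_eq_neg hF (hSodd.conj_boundedTransform hS)]
    exact hD.neg_smul_one_le_anticommutator hS hdom hc h
  · -- `α S` satisfies the hypothesis with the constant `α c`, so `α c ≤ κ` suffices.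
    have hα : 0 < κ / (c + 1) := by positivity
    refine ⟨κ / (c + 1), hα, ?_⟩
    rw [Grading.commutator_eq_of_conj_eq_neg hF
      ((hSodd.smul _).conj_boundedTransform (hS.smul hα))]
    have hle : κ / (c + 1) * c ≤ κ := by
      rw [div_mul_eq_mul_div, div_le_iff₀ (by positivity)]
      nlinarith
    generalize κ / (c + 1) = α at *
    refine (neg_le_neg (smul_le_smul_of_nonneg_right hle zero_le_one)).trans
      (hD.neg_smul_one_le_anticommutator (hS.smul hα) hdom (mul_nonneg hα.le hc)
        fun z y hzy => ?_)
    refine (smul_nonneg hα.le (h z _ ((mem_smul_graph hα.ne').1 hzy))).trans_eq ?_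
    rw [CStarModule.inner_smul_left_real, CStarModule.inner_smul_right_real, smul_add, smul_add,
      smul_smul, smul_smul, smul_smul, mul_inv_cancel₀ hα.ne', one_smul, one_smul]
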